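/- Let $x_*\notin\mathbb{Z}^2$ be a cemetery point. Let $W$ be the set of right-continuous paths $w:\mathbb{R}\to\mathbb{Z}^2\cup\{x_*\}$ such that $\{t: w(t)\neq x_*\}$ is an interval (possibly empty) and, separately in the forward and in the backward time direction, $w$ either makes finitely many jumps before reaching $x_*$, where it then stays, or is not killed and leaves every finite set in finite time. Endow $W$ with the $\sigma$-algebra generated by the coordinates, and let $\pi^*:W\to W^*$ be the quotient modulo time shift, with the induced $\sigma$-algebra on $W^*$. For $A\subset\mathbb{Z}^2$ let $W_A\subset W$ be the set of trajectories visiting $A$, and $W_A^*=\pi^*(W_A)$. Let $P_x$ be the law of the continuous-time simple random walk $(X_t)_{t\ge 0}$ on $\mathbb{Z}^2$ started at $x$, with independent exponential holding times of parameter $1$ and first jump time $\tau_1$. Write $H_A=\inf\{t\ge 0: X_t\in A\}$, $\widetilde H_A=\inf\{t\ge\tau_1: X_t\in A\}$ (with $\inf\emptyset=\infty$) and $T_A=H_{\mathbb{Z}^2\setminus A}$. For finite sets $K\subset A\subset K'\subset\mathbb{Z}^2$ and $x\in A$ put $$\rho_A^{K,K'}(x)=P_x[\widetilde H_A>T_{K'}]\,P_x[H_K>T_{K'}].$$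 Let $Q_A^{K,K'}$ be the finite measure on $W$, supported on trajectories that enter $A$ at time $0$, which is described as follows. The trajectory is at $x\in A$ at time $0$ with weight $\rho_A^{K,K'}(x)$. Given this, its forward part (times $t\ge0$) is distributed as $(X_t)_{t\ge 0}$ under $P_x[\,\cdot\mid H_K>T_{K'}]$, set equal to $x_*$ from time $T_{K'}$ on. Independently, its backward part at the times $-t$, $t>0$, is distributed as the left limits at $\tau_1+t$ of the walk under $P_x[\,\cdot\mid\widetilde H_A>T_{K'}]$, set equal to $x_*$ once $\tau_1+t>T_{K'}$. (Thus the site occupied just before time $0$ is the first site the backward walk jumps to, or $x_*$ if that site is not in $K'$. Terms with $\rho_A^{K,K'}(x)=0$ do not contribute.) **Theorem.** Let $K\subset K'$ be finite subsets of $\mathbb{Z}^2$. There is a unique finite measure $\nu^{K,K'}$ on $W^*$ with $\nu^{K,K'}(W^*\setminus W^*_{K'})=0$ such that $$1_{W_A^*}\,\nu^{K,K'}=\pi^*\circ Q_A^{K,K'}\qquad\text{for all } A \text{ with } K\subset A\subset K',$$ where $\pi^*\circ Q_A^{K,K'}$ is the image of $Q_A^{K,K'}$ under $\pi^*$ and $1_{W_A^*}\nu^{K,K'}$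 is the restriction of $\nu^{K,K'}$ to $W_A^*$. -/

import Mathlib

open MeasureTheory ProbabilityTheory Filter Topology
open scoped ENNReal

noncomputable section

/-! ### Simple random walk on `ℤ²` in continuous time -/

/-- The square lattice. -/
abbrev Site : Type := ℤ × ℤ

/-- The four nearest-neighbour steps. -/
def unitSteps : Finset Site := {(1, 0), (-1, 0), (0, 1), (0, -1)}

lemma unitSteps_nonempty : unitSteps.Nonempty := ⟨(1, 0), by simp [unitSteps]⟩

/-- Law of one step: uniform on the four unit vectors. -/
def stepLaw : Measure Site := (PMF.uniformOfFinset unitSteps unitSteps_nonempty).toMeasure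

instance isProbabilityMeasure_stepLaw : IsProbabilityMeasure stepLaw := by
  unfold stepLaw; infer_instance

/-- Sample space of the walk: the sequence of pairs (step, holding time). -/
abbrev Noise : Type := ℕ → Site × ℝ

/-- Steps uniform, holding times exponential with parameter `1`, everything independent. -/
def noiseLaw : Measure Noise := Measure.infinitePi fun _ : ℕ => stepLaw.prod (expMeasure 1)

instance isProbabilityMeasure_noiseLaw : IsProbabilityMeasure noiseLaw := by
  have : IsProbabilityMeasure (expMeasure 1) := isProbabilityMeasure_expMeasure one_pos
  unfold noiseLaw; infer_instance

/-- The discrete skeleton `Z_n` of the walk started at `x`. -/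
def skeleton (x : Site) (n : ℕ) (ω : Noise) : Site := x + ∑ k ∈ Finset.range n, (ω k).1

/-- The time of the `n`-th jump (equal to `0` for `n = 0`). -/
def jumpTime (n : ℕ) (ω : Noise) : ℝ := ∑ k ∈ Finset.range n, (ω k).2

/-- The walk `X_t = Z_{N_t}` started at `x`, where `N_t` is the number of jumps up to time `t`.
Its law under `noiseLaw` is `P_x`. -/
def walk (x : Site) (t : ℝ) (ω : Noise) : Site := skeleton x (sSup {n | jumpTime n ω ≤ t}) ω

/-- The left limit `X_{t-}` at `t > 0`: only the jumps strictly before `t` are counted. -/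
def walkLeft (x : Site) (t : ℝ) (ω : Noise) : Site :=
  skeleton x (sSup {n | jumpTime n ω < t}) ω

/-- Entrance time `H_A = inf {t ≥ 0 : X_t ∈ A}`, with `inf ∅ = ∞`. -/
def entranceTime (x : Site) (A : Set Site) (ω : Noise) : WithTop ℝ := hittingAfter (walk x) A 0 ω

/-- Hitting time `inf {t ≥ τ : X_t ∈ A}`, where `τ` is the time of the first jump. -/
def returnTime (x : Site) (A : Set Site) (ω : Noise) : WithTop ℝ :=
  hittingAfter (walk x) A (jumpTime 1 ω) ω

/-- Exit time `T_K`, the entrance time of the complement of `K`. -/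
def exitTime (x : Site) (K : Set Site) (ω : Noise) : WithTop ℝ := entranceTime x Kᶜ ω

/-- The event `{H̃_A > T_{K'}}` for the walk started at `x`. -/
def noReturn (x : Site) (A K' : Set Site) : Set Noise := {ω | exitTime x K' ω < returnTime x A ω}

/-- The event `{H_K > T_{K'}}` for the walk started at `x`. -/
def avoids (x : Site) (K K' : Set Site) : Set Noise := {ω | exitTime x K' ω < entranceTime x K ω}

/-- The equilibrium measure `e_{A,K'}(x) = P_x[H̃_A > T_{K'}]` for `x ∈ A`, and `0` otherwise. -/
def eqMeasure (A K' : Finset Site) (x : Site) : ℝ≥0∞ :=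
  if x ∈ A then noiseLaw (noReturn x A K') else 0

/-- `ρ_A^{K,K'}(x) = e_{A,K'}(x) P_x[H_K > T_{K'}] 1_A(x)`. -/
def rho (K K' A : Finset Site) (x : Site) : ℝ≥0∞ :=
  if x ∈ A then eqMeasure A K' x * noiseLaw (avoids x K K') else 0

/-! ### Bi-infinite trajectories with cemetery -/

/-- `ℤ² ∪ {x_*}`; the cemetery `x_*` is `none`. -/
def State : Type := Option Site

instance : MeasurableSpace State := ⊤

/-- The cemetery `x_*`. -/
def cemetery : State := (none : Option Site)

/-- A lattice site as a state. -/
def alive (x : Site) : State := some x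

/-- The times at which a right-continuous path jumps. -/
def jumpSet (w : ℝ → State) : Set ℝ := {t | ¬ ∀ᶠ s in 𝓝[<] t, w s = w t}

/-- Right-continuous paths `ℝ → ℤ² ∪ {x_*}` whose set of living times is an interval and such that,
separately in the forward and in the backward direction, either the path makes finitely many jumps
before reaching `x_*`, where it then stays, or it is not killed and leaves every finite set in
finite time. -/
structure IsTrajectory (w : ℝ → State) : Prop where
  right_continuous : ∀ t, ∀ᶠ s in 𝓝[>] t, w s = w t
  interval : {t | w t ≠ cemetery}.OrdConnected
  forward : ((∃ a, ∀ t, a ≤ t → w t = cemetery) ∧ ∀ a, (jumpSet w ∩ Set.Ici a).Finite) ∨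
    ∀ F : Finset Site, ∃ a, ∀ t, a ≤ t → ∃ x ∉ F, w t = alive x
  backward : ((∃ a, ∀ t, t ≤ a → w t = cemetery) ∧ ∀ a, (jumpSet w ∩ Set.Iic a).Finite) ∨
    ∀ F : Finset Site, ∃ a, ∀ t, t ≤ a → ∃ x ∉ F, w t = alive x

lemma isTrajectory_cemetery : IsTrajectory fun _ => cemetery where
  right_continuous := by simp
  interval := by simpa using Set.ordConnected_empty
  forward := Or.inl (by simp [jumpSet])
  backward := Or.inl (by simp [jumpSet])

/-- The space `W`. Its σ-algebra, generated by the coordinates `w ↦ w t`, is the one induced by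
the product σ-algebra on `ℝ → State`. -/
def Trajectory : Type := {w : ℝ → State // IsTrajectory w}

instance : MeasurableSpace Trajectory := inferInstanceAs (MeasurableSpace (Subtype IsTrajectory))

/-- Equality up to a time shift. -/
instance shiftSetoid : Setoid Trajectory where
  r w w' := ∃ s : ℝ, ∀ t, w'.1 t = w.1 (t + s)
  iseqv :=
    { refl := fun w => ⟨0, fun t => by simp⟩
      symm := by
        rintro w w' ⟨s, h⟩
        exact ⟨-s, fun t => by rw [h]; simp⟩
      trans := by
        rintro w w' w'' ⟨s, h⟩ ⟨s', h'⟩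
        exact ⟨s' + s, fun t => by rw [h', h, add_assoc]⟩ }

/-- The space `W*` of trajectories modulo time shift. A set in `W*` is measurable iff its preimage
in `W` is. -/
def TrajectoryStar : Type := Quotient shiftSetoid

instance : MeasurableSpace TrajectoryStar :=
  inferInstanceAs (MeasurableSpace (Quotient shiftSetoid))

/-- The canonical projection `π* : W → W*`. -/
def piStar (w : Trajectory) : TrajectoryStar := Quotient.mk shiftSetoid w

/-- `W_A`, the trajectories that visit `A`. -/
def entering (A : Set Site) : Set Trajectory := {w | ∃ t, ∃ x ∈ A, w.1 t = alive x}

/-- `W_A^* = π*(W_A)`. -/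
def enteringStar (A : Set Site) : Set TrajectoryStar := piStar '' entering A

/-! ### The measures `Q_A^{K,K'}` -/

open Classical in
/-- The two-sided path equal to `x` at time `0` with
* forward part the walk driven by `ω.2`, killed when it leaves `K'`;
* backward part the walk driven by `ω.1`, seen from its first jump on and killed when it leaves
  `K'`; thus the site visited just before time `0` is the first step of this walk. Left limits of
  the walk make the two-sided path right-continuous at negative times. -/
def gluePath (K' : Set Site) (x : Site) (ω : Noise × Noise) (t : ℝ) : State :=
  if 0 ≤ t then
    if (t : WithTop ℝ) < exitTime x K' ω.2 then alive (walk x t ω.2) else cemetery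
  else
    if ((jumpTime 1 ω.1 - t : ℝ) : WithTop ℝ) ≤ exitTime x K' ω.1 then
      alive (walkLeft x (jumpTime 1 ω.1 - t) ω.1)
    else cemetery

open Classical in
/-- `gluePath` as an element of `W`; on the null set where it is not a trajectory (for instance
because the walk never leaves `K'`) it is replaced by the constant `x_*`. -/
def glue (K' : Set Site) (x : Site) (ω : Noise × Noise) : Trajectory :=
  if h : IsTrajectory (gluePath K' x ω) then ⟨gluePath K' x ω, h⟩ else ⟨_, isTrajectory_cemetery⟩

/-- The measure `Q_A^{K,K'}` on `W`: the trajectory is at `x ∈ A` at time `0` with weight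
`ρ_A^{K,K'}(x)`; given this, its backward part is a walk conditioned on `H̃_A > T_{K'}` and its
forward part an independent walk conditioned on `H_K > T_{K'}`, both killed outside `K'`. -/
def Q (K K' A : Finset Site) : Measure Trajectory :=
  ∑ x ∈ A, rho K K' A x •
    (((cond noiseLaw (noReturn x A K')).prod (cond noiseLaw (avoids x K K'))).map (glue K' x))

end

/-!
Uniqueness is immediate: for `A = K'` the condition prescribes `ν` on `W*_{K'}`, and `ν` does not
charge the complement. So the only candidate is `ν = π* ∘ Q_{K'}`, and existence is the sweeping
identity `1_{W_A^*} (π* ∘ Q_{K'}) = π* ∘ Q_A` (`restrict_map_piStar_Q`).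

A trajectory under `Q_{K'}` is dead before time `0`, starts at some `x ∈ K'`, and runs in `K' \ K`
until it leaves `K'`. If it visits `A`, let `a` be the first site of `A` that it visits and `m` the
number of jumps made before. Move the root of the trajectory to this visit. Seen from there, the
past is a walk from `a` which retraces the `m` steps to `x` without returning to `A` and then leaves
`K'`, and the future is a walk from `a` which avoids `K` until it leaves `K'`: this is a trajectory
as under `Q_A`, and every one of those arises once. The weights agree because the step law is
symmetric and the holding times are i.i.d.: on the level of the noise, moving the root permutes the
independent steps and holding times and changes some of the signs of the steps
(`measurePreserving_reroot`), while the two-sided path is merely shifted in time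
(`gluePath_reroot`). Summation over `x`, `a` and `m` gives the identity.

The weight `ρ_A^{K,K'}(x)` cancels the normalization of the conditioned walks (`Q_eq`), so that
conditional laws do not enter the computation. All path properties are derived for regular noises,
which have full measure (`ae_regular`); there, entrance times and the glued path are given by the
skeleton and the jump times.
-/

noncomputable section

/-! ### The walk driven by a regular noise -/

/-- A noise is regular when the walks driven by it make their jumps one by one at times that tend to
infinity and leave every finite set. Almost all noises are regular; for some of the others `walk`
takes the default value of the supremum of an unbounded set. -/
structure Regular (ω : Noise) : Prop where
  pos : ∀ n, 0 < (ω n).2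
  unbounded : ∀ M : ℕ, ∃ n, (M : ℝ) < jumpTime n ω
  exits : ∀ (F : Finset Site) (x : Site), ∃ n, skeleton x n ω ∉ F

lemma jumpTime_zero (ω : Noise) : jumpTime 0 ω = 0 := by simp [jumpTime]

lemma jumpTime_succ (n : ℕ) (ω : Noise) : jumpTime (n + 1) ω = jumpTime n ω + (ω n).2 := by
  simp [jumpTime, Finset.sum_range_succ]

lemma skeleton_zero (x : Site) (ω : Noise) : skeleton x 0 ω = x := by simp [skeleton]

lemma skeleton_succ (x : Site) (n : ℕ) (ω : Noise) :
    skeleton x (n + 1) ω = skeleton x n ω + (ω n).1 := by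
  simp [skeleton, Finset.sum_range_succ, add_assoc]

namespace Regular

variable {ω : Noise}

lemma strictMono (h : Regular ω) : StrictMono fun n => jumpTime n ω :=
  strictMono_nat_of_lt_succ fun n => by rw [jumpTime_succ]; linarith [h.pos n]

lemma jumpTime_lt_iff (h : Regular ω) {m n : ℕ} : jumpTime m ω < jumpTime n ω ↔ m < n :=
  h.strictMono.lt_iff_lt

lemma jumpTime_le_iff (h : Regular ω) {m n : ℕ} : jumpTime m ω ≤ jumpTime n ω ↔ m ≤ n :=
  h.strictMono.le_iff_le

lemma jumpTime_nonneg (h : Regular ω) (n : ℕ) : 0 ≤ jumpTime n ω := by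
  rw [← jumpTime_zero ω]; exact h.jumpTime_le_iff.2 n.zero_le

lemma exists_lt_jumpTime (h : Regular ω) (t : ℝ) : ∃ n, t < jumpTime n ω := by
  obtain ⟨M, hM⟩ := exists_nat_ge t
  obtain ⟨n, hn⟩ := h.unbounded M
  exact ⟨n, hM.trans_lt hn⟩

lemma exists_mem_Ico (h : Regular ω) {t : ℝ} (ht : 0 ≤ t) :
    ∃ n, jumpTime n ω ≤ t ∧ t < jumpTime (n + 1) ω := by
  classical
  have hex := h.exists_lt_jumpTime t
  have hs := Nat.find_spec hex
  have h0 : Nat.find hex ≠ 0 := fun h0 => by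
    rw [h0, jumpTime_zero] at hs; exact absurd hs ht.not_gt
  obtain ⟨n, hn⟩ := Nat.exists_eq_succ_of_ne_zero h0
  refine ⟨n, not_lt.1 (Nat.find_min hex (m := n) (by omega)), ?_⟩
  rw [hn] at hs; exact hs

lemma exists_mem_Ioc (h : Regular ω) {m : ℕ} {t : ℝ} (ht : jumpTime m ω < t) :
    ∃ n, m ≤ n ∧ jumpTime n ω < t ∧ t ≤ jumpTime (n + 1) ω := by
  classical
  have hex : ∃ n, t ≤ jumpTime n ω := (h.exists_lt_jumpTime t).imp fun n => le_of_lt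
  have hs := Nat.find_spec hex
  have h0 : m < Nat.find hex := h.jumpTime_lt_iff.1 (ht.trans_le hs)
  obtain ⟨n, hn⟩ := Nat.exists_eq_succ_of_ne_zero (by omega : Nat.find hex ≠ 0)
  refine ⟨n, by omega, not_le.1 (Nat.find_min hex (m := n) (by omega)), ?_⟩
  rw [hn] at hs; exact hs

lemma walk_eq (h : Regular ω) (x : Site) {n : ℕ} {t : ℝ} (h₁ : jumpTime n ω ≤ t)
    (h₂ : t < jumpTime (n + 1) ω) : walk x t ω = skeleton x n ω := by
  have : {k | jumpTime k ω ≤ t} = Set.Iic n := by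
    ext k
    refine ⟨fun hk => ?_, fun hk => (h.jumpTime_le_iff.2 hk).trans h₁⟩
    exact Nat.lt_succ_iff.1 (h.jumpTime_lt_iff.1 (lt_of_le_of_lt hk h₂))
  rw [walk, this, csSup_Iic]

lemma walkLeft_eq (h : Regular ω) (x : Site) {n : ℕ} {t : ℝ} (h₁ : jumpTime n ω < t)
    (h₂ : t ≤ jumpTime (n + 1) ω) : walkLeft x t ω = skeleton x n ω := by
  have : {k | jumpTime k ω < t} = Set.Iic n := by
    ext k
    refine ⟨fun hk => ?_, fun hk => (h.jumpTime_le_iff.2 hk).trans_lt h₁⟩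
    exact Nat.lt_succ_iff.1 (h.jumpTime_lt_iff.1 (lt_of_lt_of_le hk h₂))
  rw [walkLeft, this, csSup_Iic]

lemma walk_jumpTime (h : Regular ω) (x : Site) (n : ℕ) :
    walk x (jumpTime n ω) ω = skeleton x n ω :=
  h.walk_eq x le_rfl (h.jumpTime_lt_iff.2 n.lt_succ_self)

lemma hittingAfter_eq (h : Regular ω) (x : Site) {B : Set Site} {m n : ℕ} (hmn : m ≤ n)
    (hn : skeleton x n ω ∈ B) (hlt : ∀ i, m ≤ i → i < n → skeleton x i ω ∉ B) :
    hittingAfter (walk x) B (jumpTime m ω) ω = (jumpTime n ω : WithTop ℝ) := by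
  have hmem : jumpTime m ω ≤ jumpTime n ω ∧ walk x (jumpTime n ω) ω ∈ B :=
    ⟨h.jumpTime_le_iff.2 hmn, by rwa [h.walk_jumpTime]⟩
  rw [hittingAfter, if_pos ⟨_, hmem⟩]
  congr 1
  refine IsLeast.csInf_eq ⟨hmem, ?_⟩
  rintro t ⟨ht, htB⟩
  obtain ⟨k, hk, hk'⟩ := h.exists_mem_Ico ((h.jumpTime_nonneg m).trans ht)
  rw [h.walk_eq x hk hk'] at htB
  have hmk : m ≤ k := Nat.lt_succ_iff.1 (h.jumpTime_lt_iff.1 (ht.trans_lt hk'))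
  by_contra! hlt'
  exact hlt k hmk (h.jumpTime_lt_iff.1 (hk.trans_lt hlt')) htB

lemma hittingAfter_eq_top (h : Regular ω) (x : Site) {B : Set Site} {m : ℕ}
    (hB : ∀ i, m ≤ i → skeleton x i ω ∉ B) :
    hittingAfter (walk x) B (jumpTime m ω) ω = ⊤ := by
  rw [hittingAfter, if_neg]
  rintro ⟨t, ht, htB⟩
  obtain ⟨k, hk, hk'⟩ := h.exists_mem_Ico ((h.jumpTime_nonneg m).trans ht)
  rw [h.walk_eq x hk hk'] at htB
  exact hB k (Nat.lt_succ_iff.1 (h.jumpTime_lt_iff.1 (ht.trans_lt hk'))) htB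

lemma exists_exitIndex (h : Regular ω) (F : Finset Site) (x : Site) :
    ∃ N, skeleton x N ω ∉ F ∧ ∀ i < N, skeleton x i ω ∈ F := by
  classical
  exact ⟨Nat.find (h.exits F x), Nat.find_spec (h.exits F x),
    fun i hi => not_not.1 (Nat.find_min (h.exits F x) hi)⟩

lemma exitTime_eq (h : Regular ω) {F : Finset Site} {x : Site} {N : ℕ}
    (hN : skeleton x N ω ∉ F) (hlt : ∀ i < N, skeleton x i ω ∈ F) :
    exitTime x F ω = (jumpTime N ω : WithTop ℝ) := by
  have := h.hittingAfter_eq x (B := (F : Set Site)ᶜ) N.zero_le (by simpa using hN)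
    (by simpa using hlt)
  rwa [jumpTime_zero] at this

/-- With `m = 0` and `m = 1` this describes the events `avoids` and `noReturn` in terms of the
skeleton. On the right `n` need not be the exit index. -/
lemma exitTime_lt_hittingAfter_iff (h : Regular ω) (x : Site) (F : Finset Site) (B : Set Site)
    (m : ℕ) : exitTime x F ω < hittingAfter (walk x) B (jumpTime m ω) ω ↔
      ∃ n, skeleton x n ω ∉ F ∧ ∀ i, m ≤ i → i ≤ n → skeleton x i ω ∉ B := by
  classical
  obtain ⟨N, hN, hlt⟩ := h.exists_exitIndex F x
  rw [h.exitTime_eq hN hlt]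
  by_cases hB : ∃ M, m ≤ M ∧ skeleton x M ω ∈ B
  · have hs := Nat.find_spec hB
    have hmin : ∀ i, m ≤ i → i < Nat.find hB → skeleton x i ω ∉ B :=
      fun i hi hi' hiB => Nat.find_min hB hi' ⟨hi, hiB⟩
    rw [h.hittingAfter_eq x hs.1 hs.2 hmin, WithTop.coe_lt_coe, h.jumpTime_lt_iff]
    refine ⟨fun hNM => ⟨N, hN, fun i hi hiN => hmin i hi (by omega)⟩, ?_⟩
    rintro ⟨n, hn, hnB⟩
    have hNn : N ≤ n := not_lt.1 fun hnN => hn (hlt n hnN)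
    by_contra! hle
    exact hnB _ hs.1 (hle.trans hNn) hs.2
  · push Not at hB
    rw [h.hittingAfter_eq_top x hB]
    exact ⟨fun _ => ⟨N, hN, fun i hi _ => hB i hi⟩, fun _ => WithTop.coe_lt_top _⟩

lemma mem_avoids_iff (h : Regular ω) (x : Site) (K F : Finset Site) :
    ω ∈ avoids x K F ↔ ∃ n, skeleton x n ω ∉ F ∧ ∀ i ≤ n, skeleton x i ω ∉ K := by
  have := h.exitTime_lt_hittingAfter_iff x F K 0
  rw [jumpTime_zero] at this
  refine this.trans (exists_congr fun n => ?_)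
  simp

lemma mem_noReturn_iff (h : Regular ω) (x : Site) (A F : Finset Site) :
    ω ∈ noReturn x A F ↔
      ∃ n, skeleton x n ω ∉ F ∧ ∀ i, 1 ≤ i → i ≤ n → skeleton x i ω ∉ A :=
  h.exitTime_lt_hittingAfter_iff x F A 1

end Regular

/-! ### The two-sided path of a pair of regular noises -/

section GluePath

variable {ω : Noise × Noise} {F : Finset Site} {x : Site}

open Classical in
lemma gluePath_of_nonneg (h : Regular ω.2) {n : ℕ} {t : ℝ}
    (h₁ : jumpTime n ω.2 ≤ t) (h₂ : t < jumpTime (n + 1) ω.2) :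
    gluePath F x ω t =
      if ∀ i ≤ n, skeleton x i ω.2 ∈ F then alive (skeleton x n ω.2) else cemetery := by
  obtain ⟨N, hN, hlt⟩ := h.exists_exitIndex F x
  have ht : 0 ≤ t := (h.jumpTime_nonneg n).trans h₁
  rw [gluePath, if_pos ht, h.exitTime_eq hN hlt, h.walk_eq x h₁ h₂]
  refine if_congr ?_ rfl rfl
  rw [WithTop.coe_lt_coe]
  constructor
  · intro htN i hi
    exact hlt i (hi.trans_lt (h.jumpTime_lt_iff.1 (h₁.trans_lt htN)))
  · intro hall
    have : n < N := not_le.1 fun hNn => hN (hall N hNn)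
    exact h₂.trans_le (h.jumpTime_le_iff.2 this)

open Classical in
lemma gluePath_of_neg (h : Regular ω.1) {n : ℕ} (hn : 1 ≤ n) {t : ℝ}
    (h₁ : jumpTime n ω.1 < jumpTime 1 ω.1 - t) (h₂ : jumpTime 1 ω.1 - t ≤ jumpTime (n + 1) ω.1) :
    gluePath F x ω t =
      if ∀ i ≤ n, skeleton x i ω.1 ∈ F then alive (skeleton x n ω.1) else cemetery := by
  obtain ⟨N, hN, hlt⟩ := h.exists_exitIndex F x
  have ht : ¬ 0 ≤ t := by
    have := h.jumpTime_le_iff.2 hn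
    linarith
  rw [gluePath, if_neg ht, h.exitTime_eq hN hlt, h.walkLeft_eq x h₁ h₂]
  refine if_congr ?_ rfl rfl
  rw [WithTop.coe_le_coe]
  constructor
  · intro htN i hi
    exact hlt i (hi.trans_lt (h.jumpTime_lt_iff.1 (h₁.trans_le htN)))
  · intro hall
    have : n < N := not_le.1 fun hNn => hN (hall N hNn)
    exact h₂.trans (h.jumpTime_le_iff.2 this)

lemma alive_ne_cemetery (y : Site) : alive y ≠ cemetery := Option.some_ne_none y

lemma alive_injective : Function.Injective alive := Option.some_injective Site

lemma State.eq_cemetery_or_alive (c : State) : c = cemetery ∨ ∃ y, c = alive y := by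
  cases c with
  | none => exact Or.inl rfl
  | some y => exact Or.inr ⟨y, rfl⟩

lemma gluePath_eq_alive_iff_of_nonneg (h : Regular ω.2) {t : ℝ} (ht : 0 ≤ t) (y : Site) :
    gluePath F x ω t = alive y ↔ ∃ n, (∀ i ≤ n, skeleton x i ω.2 ∈ F) ∧ jumpTime n ω.2 ≤ t ∧
      t < jumpTime (n + 1) ω.2 ∧ skeleton x n ω.2 = y := by
  classical
  constructor
  · intro hy
    obtain ⟨n, h₁, h₂⟩ := h.exists_mem_Ico ht
    rw [gluePath_of_nonneg h h₁ h₂] at hy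
    split_ifs at hy with hall
    · exact ⟨n, hall, h₁, h₂, alive_injective hy⟩
    · exact absurd hy.symm (alive_ne_cemetery y)
  · rintro ⟨n, hall, h₁, h₂, rfl⟩
    rw [gluePath_of_nonneg h h₁ h₂, if_pos hall]

lemma gluePath_eq_alive_iff_of_neg (h : Regular ω.1) {t : ℝ} (ht : t < 0) (y : Site) :
    gluePath F x ω t = alive y ↔ ∃ n, 1 ≤ n ∧ (∀ i ≤ n, skeleton x i ω.1 ∈ F) ∧
      jumpTime n ω.1 < jumpTime 1 ω.1 - t ∧ jumpTime 1 ω.1 - t ≤ jumpTime (n + 1) ω.1 ∧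
      skeleton x n ω.1 = y := by
  classical
  constructor
  · intro hy
    obtain ⟨n, hn, h₁, h₂⟩ := h.exists_mem_Ioc (m := 1) (t := jumpTime 1 ω.1 - t) (by linarith)
    rw [gluePath_of_neg h hn h₁ h₂] at hy
    split_ifs at hy with hall
    · exact ⟨n, hn, hall, h₁, h₂, alive_injective hy⟩
    · exact absurd hy.symm (alive_ne_cemetery y)
  · rintro ⟨n, hn, hall, h₁, h₂, rfl⟩
    rw [gluePath_of_neg h hn h₁ h₂, if_pos hall]

lemma exists_Ico_gluePath_eq (h₁ : Regular ω.1) (h₂ : Regular ω.2) (t : ℝ) :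
    ∃ a b, a ≤ t ∧ t < b ∧ ∀ s, a ≤ s → s < b → gluePath F x ω s = gluePath F x ω t := by
  classical
  by_cases ht : 0 ≤ t
  · obtain ⟨n, hn, hn'⟩ := h₂.exists_mem_Ico ht
    refine ⟨_, _, hn, hn', fun s hs hs' => ?_⟩
    rw [gluePath_of_nonneg h₂ hs hs', gluePath_of_nonneg h₂ hn hn']
  · obtain ⟨n, h1n, hn, hn'⟩ :=
      h₁.exists_mem_Ioc (m := 1) (t := jumpTime 1 ω.1 - t) (by linarith)
    refine ⟨jumpTime 1 ω.1 - jumpTime (n + 1) ω.1, jumpTime 1 ω.1 - jumpTime n ω.1,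
      by linarith, by linarith, fun s hs hs' => ?_⟩
    rw [gluePath_of_neg h₁ h1n (by linarith) (by linarith), gluePath_of_neg h₁ h1n hn hn']

lemma gluePath_eq_cemetery_of_ge (h : Regular ω.2) {N : ℕ} (hN : skeleton x N ω.2 ∉ F) {t : ℝ}
    (ht : jumpTime N ω.2 ≤ t) : gluePath F x ω t = cemetery := by
  classical
  obtain ⟨n, hn, hn'⟩ := h.exists_mem_Ico ((h.jumpTime_nonneg N).trans ht)
  have hNn : N ≤ n := Nat.lt_succ_iff.1 (h.jumpTime_lt_iff.1 (ht.trans_lt hn'))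
  rw [gluePath_of_nonneg h hn hn', if_neg fun hall => hN (hall N hNn)]

lemma gluePath_eq_cemetery_of_lt (h : Regular ω.1) {N : ℕ} (hN1 : 1 ≤ N)
    (hN : skeleton x N ω.1 ∉ F) {t : ℝ}
    (ht : t < jumpTime 1 ω.1 - jumpTime N ω.1) : gluePath F x ω t = cemetery := by
  classical
  obtain ⟨n, hNn, hn, hn'⟩ := h.exists_mem_Ioc (m := N) (t := jumpTime 1 ω.1 - t) (by linarith)
  rw [gluePath_of_neg h (hN1.trans hNn) hn hn', if_neg fun hall => hN (hall N hNn)]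

lemma isTrajectory_gluePath (h₁ : Regular ω.1) (h₂ : Regular ω.2) (hx : x ∈ F) :
    IsTrajectory (gluePath F x ω) := by
  classical
  obtain ⟨M, hM, hltM⟩ := h₁.exists_exitIndex F x
  obtain ⟨N, hN, hltN⟩ := h₂.exists_exitIndex F x
  have hM1 : 1 ≤ M := Nat.one_le_iff_ne_zero.2 fun h0 => hM (by rwa [h0, skeleton_zero])
  -- The jumps sit at the jump times of the two walks up to their exits.
  have hjump : (jumpSet (gluePath F x ω)).Finite := by
    refine (((Finset.range (N + 1)).image fun i => jumpTime i ω.2).finite_toSet.union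
      ((Finset.range (M + 1)).image fun i => jumpTime 1 ω.1 - jumpTime i ω.1).finite_toSet).subset
      fun t ht => ?_
    by_contra hnot
    simp only [Finset.coe_image, Set.mem_union, Set.mem_image, Finset.coe_range, Set.mem_Iio,
      not_or, not_exists, not_and] at hnot
    apply ht
    obtain ⟨a, ha, hconst⟩ : ∃ a < t, ∀ s, a < s → s < t →
        gluePath F x ω s = gluePath F x ω t := by
      by_cases ht0 : 0 ≤ t
      · obtain ⟨n, hn, hn'⟩ := h₂.exists_mem_Ico ht0
        rcases hn.lt_or_eq with hlt | heq
        · refine ⟨_, hlt, fun s hs hs' => ?_⟩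
          rw [gluePath_of_nonneg h₂ hs.le (hs'.trans hn'), gluePath_of_nonneg h₂ hn hn']
        · have hNn : N < n := by
            by_contra! hle
            exact hnot.1 n (by omega) heq
          refine ⟨jumpTime N ω.2, heq ▸ h₂.jumpTime_lt_iff.2 hNn, fun s hs hs' => ?_⟩
          rw [gluePath_eq_cemetery_of_ge h₂ hN hs.le,
            gluePath_eq_cemetery_of_ge h₂ hN (hs.trans hs').le]
      · obtain ⟨n, h1n, hn, hn'⟩ :=
          h₁.exists_mem_Ioc (m := 1) (t := jumpTime 1 ω.1 - t) (by linarith)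
        rcases hn'.lt_or_eq with hlt | heq
        · refine ⟨jumpTime 1 ω.1 - jumpTime (n + 1) ω.1, by linarith, fun s hs hs' => ?_⟩
          rw [gluePath_of_neg h₁ h1n (by linarith) (by linarith), gluePath_of_neg h₁ h1n hn hn']
        · have hMn : M < n + 1 := by
            by_contra! hle
            exact hnot.2 (n + 1) (by omega) (by linarith)
          have := h₁.jumpTime_lt_iff.2 hMn
          refine ⟨t - 1, by linarith, fun s hs hs' => ?_⟩
          rw [gluePath_eq_cemetery_of_lt h₁ hM1 hM (by linarith),
            gluePath_eq_cemetery_of_lt h₁ hM1 hM (by linarith)]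
    filter_upwards [Ioo_mem_nhdsLT ha] with s hs using hconst s hs.1 hs.2
  refine ⟨fun t => ?_, ?_, Or.inl ⟨⟨jumpTime N ω.2, fun t ht => ?_⟩, fun a => ?_⟩,
    Or.inl ⟨⟨jumpTime 1 ω.1 - jumpTime M ω.1 - 1, fun t ht => ?_⟩, fun a => ?_⟩⟩
  · obtain ⟨a, b, ha, hb, hc⟩ := exists_Ico_gluePath_eq (F := F) (x := x) h₁ h₂ t
    filter_upwards [Ioo_mem_nhdsGT hb] with s hs using hc s (ha.trans hs.1.le) hs.2
  · have : {t | gluePath F x ω t ≠ cemetery} =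
        Set.Ico (jumpTime 1 ω.1 - jumpTime M ω.1) (jumpTime N ω.2) := by
      ext t
      constructor
      · intro ht
        constructor
        · by_contra! hlt
          exact ht (gluePath_eq_cemetery_of_lt h₁ hM1 hM hlt)
        · by_contra! hle
          exact ht (gluePath_eq_cemetery_of_ge h₂ hN hle)
      · rintro ⟨hl, hr⟩
        by_cases ht0 : 0 ≤ t
        · obtain ⟨n, hn, hn'⟩ := h₂.exists_mem_Ico ht0
          have hnN : n < N := h₂.jumpTime_lt_iff.1 (hn.trans_lt hr)
          rw [Set.mem_ofPred_eq, gluePath_of_nonneg h₂ hn hn',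
            if_pos fun i hi => hltN i (by omega)]
          exact alive_ne_cemetery _
        · obtain ⟨n, h1n, hn, hn'⟩ :=
            h₁.exists_mem_Ioc (m := 1) (t := jumpTime 1 ω.1 - t) (by linarith)
          have hnM : n < M := h₁.jumpTime_lt_iff.1 (by linarith)
          rw [Set.mem_ofPred_eq, gluePath_of_neg h₁ h1n hn hn',
            if_pos fun i hi => hltM i (by omega)]
          exact alive_ne_cemetery _
    rw [this]; exact Set.ordConnected_Ico
  · exact gluePath_eq_cemetery_of_ge h₂ hN ht
  · exact hjump.inter_of_left _
  · exact gluePath_eq_cemetery_of_lt h₁ hM1 hM (by linarith)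
  · exact hjump.inter_of_left _

lemma glue_val (h₁ : Regular ω.1) (h₂ : Regular ω.2) (hx : x ∈ F) :
    (glue F x ω).1 = gluePath F x ω := by
  have : glue F x ω = (⟨_, isTrajectory_gluePath h₁ h₂ hx⟩ : {w // IsTrajectory w}) :=
    dif_pos (isTrajectory_gluePath h₁ h₂ hx)
  rw [this]

end GluePath

/-! ### Almost all noises are regular -/

/-- The blocks of length `L` of an i.i.d. sequence are i.i.d. -/
lemma map_blocks_infinitePi {α : Type*} [MeasurableSpace α] (μ : Measure α)
    [IsProbabilityMeasure μ] (L : ℕ) [NeZero L] :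
    (Measure.infinitePi fun _ : ℕ => μ).map (fun ω (j : ℕ) (i : Fin L) => ω (j * L + i)) =
      Measure.infinitePi fun _ : ℕ => Measure.infinitePi fun _ : Fin L => μ := by
  have h₁ := Measure.map_infinitePi_infinitePi_of_inj (P := fun _ : ℕ => μ)
    (Nat.divModEquiv L).symm.injective
  have h₂ := Measure.infinitePi_map_curry (fun (_ : ℕ) (_ : Fin L) => μ)
  rw [← h₂]
  change _ = Measure.map _
    (Measure.infinitePi fun i => (fun _ : ℕ => μ) ((Nat.divModEquiv L).symm i))
  rw [← h₁, Measure.map_map (MeasurableEquiv.measurable _) (by fun_prop)]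
  rfl

lemma ae_exists_block_mem {α : Type*} [MeasurableSpace α] (μ : Measure α)
    [IsProbabilityMeasure μ] (L : ℕ) [NeZero L] {E : Set (Fin L → α)} (hE : MeasurableSet E)
    (h0 : Measure.infinitePi (fun _ : Fin L => μ) E ≠ 0) :
    ∀ᵐ ω ∂Measure.infinitePi fun _ : ℕ => μ, ∃ j : ℕ, (fun i : Fin L => ω (j * L + i)) ∈ E := by
  have hmeas : Measurable fun (ω : ℕ → α) (j : ℕ) (i : Fin L) => ω (j * L + i) := by fun_prop
  have key : ∀ᵐ b ∂Measure.infinitePi fun _ : ℕ => Measure.infinitePi fun _ : Fin L => μ,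
      ∃ j, b j ∈ E := by
    rw [ae_iff]
    set p := Measure.infinitePi (fun _ : Fin L => μ) Eᶜ with hp
    have hp1 : p < 1 := by
      rw [hp, prob_compl_eq_one_sub hE]
      exact ENNReal.sub_lt_self ENNReal.one_ne_top one_ne_zero h0
    refine le_antisymm (ge_of_tendsto' (ENNReal.tendsto_pow_atTop_nhds_zero_of_lt_one hp1)
      fun n => ?_) zero_le
    calc _ ≤ Measure.infinitePi (fun _ : ℕ => Measure.infinitePi fun _ : Fin L => μ)
          (Set.pi (Finset.range n) fun _ => Eᶜ) :=
          measure_mono fun b (hb : ¬ ∃ j, b j ∈ E) j _ hj => hb ⟨j, hj⟩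
      _ = p ^ n := by
          rw [Measure.infinitePi_pi _ fun _ _ => hE.compl]
          simp [hp]
  rw [← map_blocks_infinitePi μ L] at key
  exact ae_of_ae_map hmeas.aemeasurable key

instance isProbabilityMeasure_expMeasure_one : IsProbabilityMeasure (expMeasure 1) :=
  isProbabilityMeasure_expMeasure one_pos

lemma expMeasure_one_Ioi {t : ℝ} (ht : 0 ≤ t) :
    expMeasure 1 (Set.Ioi t) = ENNReal.ofReal (Real.exp (-t)) := by
  have h := cdf_expMeasure_eq one_pos t
  rw [cdf_eq_real, if_pos ht] at h
  rw [← ofReal_measureReal, ← Set.compl_Iic, probReal_compl_eq_one_sub measurableSet_Iic, h]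
  congr 1; simp

lemma stepLaw_singleton {e : Site} (he : e ∈ unitSteps) : stepLaw {e} = 4⁻¹ := by
  rw [stepLaw, PMF.toMeasure_apply_singleton _ _ (measurableSet_singleton _),
    PMF.uniformOfFinset_apply_of_mem _ he]
  congr 1

lemma expMeasure_one_Ioi_ne_zero {t : ℝ} (ht : 0 ≤ t) : expMeasure 1 (Set.Ioi t) ≠ 0 := by
  rw [expMeasure_one_Ioi ht]; simp [Real.exp_pos]

/-- Runs of steps to the right with holding times longer than `1` of any given length occur almost
surely: they make the walk leave every finite set and its jump times unbounded. -/
lemma ae_exists_run (L : ℕ) [NeZero L] :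
    ∀ᵐ ω ∂noiseLaw, ∃ j : ℕ, ∀ i < L, (ω (j * L + i)).1 = (1, 0) ∧ 1 < (ω (j * L + i)).2 := by
  have := ae_exists_block_mem (stepLaw.prod (expMeasure 1)) L
    (E := Set.pi (Finset.univ : Finset (Fin L)) fun _ => {((1, 0) : Site)} ×ˢ Set.Ioi 1)
    (MeasurableSet.pi (Set.to_countable _) fun _ _ =>
      (measurableSet_singleton _).prod measurableSet_Ioi) ?_
  · filter_upwards [this] with ω hω
    obtain ⟨j, hj⟩ := hω
    refine ⟨j, fun i hi => ?_⟩
    have := hj ⟨i, hi⟩ (by simp)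
    simpa using this
  · rw [Measure.infinitePi_pi _ fun _ _ => (measurableSet_singleton _).prod measurableSet_Ioi,
      Finset.prod_ne_zero_iff]
    intro i _
    rw [Measure.prod_prod, stepLaw_singleton (by simp [unitSteps])]
    exact mul_ne_zero (by simp) (expMeasure_one_Ioi_ne_zero zero_le_one)

lemma ae_forall_holdingTime_pos : ∀ᵐ ω ∂noiseLaw, ∀ n, 0 < (ω n).2 := by
  rw [ae_all_iff]
  intro n
  have h : ∀ᵐ t ∂expMeasure 1, 0 < t := by
    rw [ae_iff]
    have : {t : ℝ | ¬ 0 < t} = (Set.Ioi 0)ᶜ := rfl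
    rw [this, prob_compl_eq_zero_iff measurableSet_Ioi, expMeasure_one_Ioi le_rfl]
    simp
  have h₂ : ∀ᵐ p ∂stepLaw.prod (expMeasure 1), 0 < p.2 :=
    Measure.quasiMeasurePreserving_snd.ae h
  exact (measurePreserving_eval_infinitePi (fun _ : ℕ => stepLaw.prod (expMeasure 1))
    n).quasiMeasurePreserving.ae h₂

lemma ae_regular : ∀ᵐ ω ∂noiseLaw, Regular ω := by
  have hruns : ∀ᵐ ω ∂noiseLaw, ∀ L : ℕ, ∃ m : ℕ, ∀ i ≤ L, (ω (m + i)).1 = (1, 0) ∧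
      1 < (ω (m + i)).2 := by
    rw [ae_all_iff]
    intro L
    filter_upwards [ae_exists_run (L + 1)] with ω ⟨j, hj⟩
    exact ⟨j * (L + 1), fun i hi => hj i (by omega)⟩
  filter_upwards [ae_forall_holdingTime_pos, hruns] with ω hpos hrun
  refine ⟨hpos, fun M => ?_, fun F x => ?_⟩
  · obtain ⟨m, hm⟩ := hrun M
    have hlow : ∀ i ≤ M + 1, (i : ℝ) ≤ jumpTime (m + i) ω := by
      intro i
      induction i with
      | zero =>
        intro _
        rw [Nat.cast_zero, jumpTime]
        exact Finset.sum_nonneg fun k _ => (hpos k).le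
      | succ i ih =>
        intro hi
        have h₁ := ih (by omega)
        have h₂ := (hm i (by omega)).2
        rw [← add_assoc, jumpTime_succ]; push_cast; linarith
    refine ⟨m + (M + 1), lt_of_lt_of_le ?_ (hlow (M + 1) le_rfl)⟩
    push_cast; linarith
  · -- a run of `F.card` steps to the right visits `F.card + 1` sites
    by_contra! hall
    obtain ⟨m, hm⟩ := hrun F.card
    have hpath : ∀ i ≤ F.card + 1, skeleton x (m + i) ω = skeleton x m ω + ((i : ℤ), 0) := by
      intro i
      induction i with
      | zero => intro _; simp
      | succ i ih =>
        intro hi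
        rw [← add_assoc, skeleton_succ, ih (by omega), (hm i (by omega)).1]
        ext <;> simp [add_assoc]
    have hinj : Set.InjOn (fun i => skeleton x (m + i) ω) (Finset.range (F.card + 1)) := by
      intro i hi k hk hik
      simp only [Finset.coe_range, Set.mem_Iio] at hi hk
      simp only [hpath i (by omega), hpath k (by omega), add_right_inj, Prod.mk.injEq] at hik
      exact_mod_cast hik.1
    have := Finset.card_le_card_of_injOn (s := Finset.range (F.card + 1)) (t := F) _
      (fun i _ => hall (m + i)) hinj
    simp at this

/-! ### Measurability of the two-sided path and of the trajectories that visit a set -/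

lemma measurable_skeleton (x : Site) (n : ℕ) : Measurable (skeleton x n) := by
  unfold skeleton; fun_prop

lemma measurable_jumpTime (n : ℕ) : Measurable (jumpTime n) := by
  unfold jumpTime; fun_prop

instance : Countable State := inferInstanceAs (Countable (Option Site))
instance : MeasurableSingletonClass State := ⟨fun _ => trivial⟩

lemma measurable_of_preimage_alive {Ω : Type*} [MeasurableSpace Ω] {f : Ω → State}
    (h : ∀ y, MeasurableSet {ω | f ω = alive y}) : Measurable f := by
  refine measurable_to_countable' fun c => ?_
  rcases c.eq_cemetery_or_alive with rfl | ⟨y, rfl⟩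
  · have : f ⁻¹' {cemetery} = (⋃ y, {ω | f ω = alive y})ᶜ := by
      ext ω
      simp only [Set.mem_preimage, Set.mem_singleton_iff, Set.mem_compl_iff, Set.mem_iUnion,
        Set.mem_ofPred_eq, not_exists]
      constructor
      · intro h y hy; exact alive_ne_cemetery y (hy.symm.trans h)
      · intro h
        rcases (f ω).eq_cemetery_or_alive with h' | ⟨y, hy⟩
        · exact h'
        · exact absurd hy (h y)
    rw [this]
    exact (MeasurableSet.iUnion h).compl
  · exact h y

lemma ae_regular_pair : ∀ᵐ ω ∂noiseLaw.prod noiseLaw, Regular ω.1 ∧ Regular ω.2 :=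
  (Measure.quasiMeasurePreserving_fst.ae ae_regular).and
    (Measure.quasiMeasurePreserving_snd.ae ae_regular)

/-- On a measurable set of regular noises of full measure, each coordinate of the glued path is
described by countably many conditions on skeletons and jump times. -/
lemma aemeasurable_glue {F : Finset Site} {x : Site} (hx : x ∈ F) :
    AEMeasurable (glue F x) (noiseLaw.prod noiseLaw) := by
  classical
  set P := noiseLaw.prod noiseLaw with hP
  set S : Set (Noise × Noise) := (toMeasurable P {ω | ¬ (Regular ω.1 ∧ Regular ω.2)})ᶜ with hS
  have hSm : MeasurableSet S := (measurableSet_toMeasurable _ _).compl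
  have hSreg : ∀ ω ∈ S, Regular ω.1 ∧ Regular ω.2 := fun ω hω => by
    by_contra hnot
    exact hω (subset_toMeasurable _ _ hnot)
  have hSae : ∀ᵐ ω ∂P, ω ∈ S := by
    rw [ae_iff]
    have : {ω | ω ∉ S} = toMeasurable P {ω | ¬ (Regular ω.1 ∧ Regular ω.2)} := by
      ext ω; simp [hS]
    rw [this, measure_toMeasurable]
    exact ae_regular_pair
  let g : Noise × Noise → Trajectory :=
    fun ω => if ω ∈ S then glue F x ω else ⟨_, isTrajectory_cemetery⟩
  refine ⟨g, ?_, ?_⟩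
  swap
  · filter_upwards [hSae] with ω hω using (if_pos hω).symm
  have hval : Measurable fun ω => (g ω).1 := by
    refine measurable_pi_lambda _ fun t => measurable_of_preimage_alive fun y => ?_
    have hsets : {ω | (g ω).1 t = alive y} = S ∩ {ω | gluePath F x ω t = alive y} := by
      ext ω
      by_cases hω : ω ∈ S
      · have : (g ω).1 = gluePath F x ω := by
          rw [show g ω = glue F x ω from if_pos hω]
          exact glue_val (hSreg ω hω).1 (hSreg ω hω).2 hx
        simp [this, hω]
      · have : (g ω).1 t = cemetery := by
          rw [show g ω = ⟨_, isTrajectory_cemetery⟩ from if_neg hω]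
        simp [this, hω, (alive_ne_cemetery y).symm]
    rw [hsets]
    have hsk : ∀ n, Measurable fun ω : Noise × Noise => skeleton x n ω.1 := fun n =>
      (measurable_skeleton x n).comp measurable_fst
    have hsk' : ∀ n, Measurable fun ω : Noise × Noise => skeleton x n ω.2 := fun n =>
      (measurable_skeleton x n).comp measurable_snd
    have hj : ∀ n, Measurable fun ω : Noise × Noise => jumpTime n ω.1 := fun n =>
      (measurable_jumpTime n).comp measurable_fst
    have hj' : ∀ n, Measurable fun ω : Noise × Noise => jumpTime n ω.2 := fun n =>
      (measurable_jumpTime n).comp measurable_snd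
    by_cases ht : 0 ≤ t
    · have : S ∩ {ω | gluePath F x ω t = alive y} = S ∩ ⋃ n, ((⋂ i, ⋂ _ : i ≤ n,
          {ω | skeleton x i ω.2 ∈ F}) ∩ ({ω | jumpTime n ω.2 ≤ t} ∩
          ({ω | t < jumpTime (n + 1) ω.2} ∩ {ω | skeleton x n ω.2 = y}))) := by
        ext ω
        refine and_congr_right fun hω => ?_
        rw [Set.mem_ofPred_eq, gluePath_eq_alive_iff_of_nonneg (hSreg ω hω).2 ht]
        simp
      rw [this]
      refine hSm.inter (MeasurableSet.iUnion fun n => ((MeasurableSet.iInter fun i =>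
        MeasurableSet.iInter fun _ => hsk' i (Set.to_countable _).measurableSet)).inter
        ((measurableSet_le (hj' n) measurable_const).inter
          ((measurableSet_lt measurable_const (hj' (n + 1))).inter
            (hsk' n (measurableSet_singleton y)))))
    · have : S ∩ {ω | gluePath F x ω t = alive y} = S ∩ ⋃ n, ⋃ _ : 1 ≤ n, ((⋂ i, ⋂ _ : i ≤ n,
          {ω | skeleton x i ω.1 ∈ F}) ∩ ({ω | jumpTime n ω.1 < jumpTime 1 ω.1 - t} ∩
          ({ω | jumpTime 1 ω.1 - t ≤ jumpTime (n + 1) ω.1} ∩ {ω | skeleton x n ω.1 = y}))) := by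
        ext ω
        refine and_congr_right fun hω => ?_
        rw [Set.mem_ofPred_eq, gluePath_eq_alive_iff_of_neg (hSreg ω hω).1 (not_le.1 ht)]
        simp only [Set.mem_iUnion, Set.mem_inter_iff, Set.mem_iInter, Set.mem_ofPred_eq,
          exists_prop]
      rw [this]
      refine hSm.inter (MeasurableSet.iUnion fun n => MeasurableSet.iUnion fun _ =>
        ((MeasurableSet.iInter fun i => MeasurableSet.iInter fun _ =>
          hsk i (Set.to_countable _).measurableSet)).inter
        ((measurableSet_lt (hj n) ((hj 1).sub_const t)).inter
          ((measurableSet_le ((hj 1).sub_const t) (hj (n + 1))).inter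
            (hsk n (measurableSet_singleton y)))))
  exact hval.subtype_mk (h := fun ω => (g ω).2)

lemma measurable_piStar : Measurable piStar := measurable_quotient_mk'

lemma mem_entering_iff_rat (A : Set Site) (w : Trajectory) :
    w ∈ entering A ↔ ∃ q : ℚ, ∃ x ∈ A, w.1 q = alive x := by
  refine ⟨?_, fun ⟨q, hq⟩ => ⟨q, hq⟩⟩
  rintro ⟨t, x, hx, ht⟩
  obtain ⟨b, hb, hconst⟩ := mem_nhdsGT_iff_exists_Ioo_subset.1 (w.2.right_continuous t)
  obtain ⟨q, hq, hq'⟩ := exists_rat_btwn (Set.mem_Ioi.1 hb)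
  exact ⟨q, x, hx, (hconst ⟨hq, hq'⟩ : w.1 q = w.1 t).trans ht⟩

lemma measurable_coord (t : ℝ) : Measurable fun w : Trajectory => w.1 t :=
  (measurable_pi_apply t).comp measurable_subtype_coe

lemma measurableSet_entering (A : Set Site) : MeasurableSet (entering A) := by
  have : entering A = ⋃ q : ℚ, (fun w : Trajectory => w.1 q) ⁻¹' (alive '' A) := by
    ext w
    rw [mem_entering_iff_rat]
    simp only [Set.mem_iUnion, Set.mem_preimage, Set.mem_image, eq_comm]
  rw [this]
  exact MeasurableSet.iUnion fun q => measurable_coord q trivial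

lemma piStar_eq_iff {w w' : Trajectory} :
    piStar w = piStar w' ↔ ∃ s : ℝ, ∀ t, w'.1 t = w.1 (t + s) :=
  Quotient.eq

lemma preimage_enteringStar (A : Set Site) : piStar ⁻¹' enteringStar A = entering A := by
  refine Set.Subset.antisymm ?_ (Set.subset_preimage_image _ _)
  rintro w ⟨w', ⟨t, x, hx, ht⟩, h⟩
  obtain ⟨s, hs⟩ := piStar_eq_iff.1 h.symm
  exact ⟨t + s, x, hx, (hs t).symm.trans ht⟩

lemma measurableSet_enteringStar (A : Set Site) : MeasurableSet (enteringStar A) := by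
  change MeasurableSet (piStar ⁻¹' enteringStar A)
  rw [preimage_enteringStar]; exact measurableSet_entering A

/-! ### Reversal of the noise -/

lemma measurePreserving_zip_infinitePi {ι α β : Type*} [MeasurableSpace α] [MeasurableSpace β]
    (μ : Measure α) (ν : Measure β) [IsProbabilityMeasure μ] [IsProbabilityMeasure ν] :
    MeasurePreserving (fun (u : (ι → α) × (ι → β)) (i : ι) => (u.1 i, u.2 i))
      ((Measure.infinitePi fun _ => μ).prod (Measure.infinitePi fun _ => ν))
      (Measure.infinitePi fun _ => μ.prod ν) := by
  have hm : Measurable fun (u : (ι → α) × (ι → β)) (i : ι) => (u.1 i, u.2 i) := by fun_prop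
  refine ⟨hm, Measure.eq_infinitePi _ fun s t ht => ?_⟩
  have hbox : MeasurableSet (Set.pi Set.univ fun i : s => t i) :=
    MeasurableSet.univ_pi fun i => ht i
  have hsm := (MeasurableEquiv.arrowProdEquivProdArrow α β s).symm.measurable
  have heq : (fun (u : (ι → α) × (ι → β)) (i : ι) => (u.1 i, u.2 i)) ⁻¹' Set.pi s t =
      Prod.map s.restrict s.restrict ⁻¹' ((MeasurableEquiv.arrowProdEquivProdArrow α β s).symm ⁻¹'
        Set.pi Set.univ fun i : s => t i) := by
    ext u
    simp [Set.mem_pi, MeasurableEquiv.arrowProdEquivProdArrow, Equiv.arrowProdEquivProdArrow]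
  rw [Measure.map_apply hm (MeasurableSet.pi s.countable_toSet fun i _ => ht i), heq,
    ← Measure.map_apply (by fun_prop) (hsm hbox),
    ← Measure.map_prod_map _ _ (by fun_prop) (by fun_prop),
    Measure.infinitePi_map_restrict, Measure.infinitePi_map_restrict,
    (measurePreserving_arrowProdEquivProdArrow α β s (fun _ => μ)
      (fun _ => ν)).symm.measure_preimage hbox.nullMeasurableSet, Measure.pi_pi, Finset.prod_coe_sort s fun i => μ.prod ν (t i)]

lemma measurePreserving_sumElim_infinitePi {ι κ α : Type*} [MeasurableSpace α]
    (μ : Measure α) [IsProbabilityMeasure μ] :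
    MeasurePreserving (MeasurableEquiv.sumPiEquivProdPi fun _ : ι ⊕ κ => α)
      (Measure.infinitePi fun _ => μ)
      ((Measure.infinitePi fun _ => μ).prod (Measure.infinitePi fun _ => μ)) := by
  suffices h : MeasurePreserving (MeasurableEquiv.sumPiEquivProdPi fun _ : ι ⊕ κ => α).symm
      ((Measure.infinitePi fun _ => μ).prod (Measure.infinitePi fun _ => μ))
      (Measure.infinitePi fun _ => μ) from h.symm
  refine ⟨MeasurableEquiv.measurable _, Measure.eq_infinitePi _ fun s t ht => ?_⟩
  have heq : (MeasurableEquiv.sumPiEquivProdPi fun _ : ι ⊕ κ => α).symm ⁻¹' Set.pi s t =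
      (Set.pi s.toLeft fun i => t (Sum.inl i)) ×ˢ (Set.pi s.toRight fun i => t (Sum.inr i)) := by
    ext u
    simp [Set.mem_pi, MeasurableEquiv.sumPiEquivProdPi, Equiv.sumPiEquivProdPi]
  rw [MeasurableEquiv.map_apply, heq, Measure.prod_prod, Measure.infinitePi_pi _ fun i _ => ht _,
    Measure.infinitePi_pi _ fun i _ => ht _]
  exact (Finset.prod_sum_eq_prod_toLeft_mul_prod_toRight s fun i => μ (t i)).symm

lemma measurePreserving_reindex_infinitePi {ι κ α : Type*} [MeasurableSpace α]
    (μ : Measure α) [IsProbabilityMeasure μ] {σ : ι → κ} (hσ : Function.Injective σ)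
    {g : ι → α → α} (hg : ∀ i, MeasurePreserving (g i) μ μ) :
    MeasurePreserving (fun (f : κ → α) i => g i (f (σ i))) (Measure.infinitePi fun _ => μ)
      (Measure.infinitePi fun _ => μ) := by
  have h₁ : MeasurePreserving (fun (f : κ → α) i => f (σ i)) (Measure.infinitePi fun _ => μ)
      (Measure.infinitePi fun _ => μ) :=
    ⟨by fun_prop, Measure.map_infinitePi_infinitePi_of_inj hσ⟩
  have h₂ : MeasurePreserving (fun (f : ι → α) i => g i (f i)) (Measure.infinitePi fun _ => μ)
      (Measure.infinitePi fun _ => μ) := by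
    refine ⟨measurable_pi_lambda _ fun i => (hg i).measurable.comp (measurable_pi_apply i), ?_⟩
    rw [Measure.infinitePi_map_pi _ fun i => (hg i).measurable]
    congr 1
    ext1 i
    exact (hg i).map_eq
  exact h₂.comp h₁

lemma measurePreserving_neg_stepLaw : MeasurePreserving (fun e : Site => -e) stepLaw stepLaw := by
  refine ⟨measurable_neg, Measure.ext_of_singleton fun e => ?_⟩
  rw [Measure.map_apply measurable_neg (measurableSet_singleton e)]
  have : (fun e : Site => -e) ⁻¹' {e} = {-e} := by ext; simp
  have hmem : -e ∈ unitSteps ↔ e ∈ unitSteps := by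
    obtain ⟨a, b⟩ := e
    simp only [unitSteps, Finset.mem_insert, Finset.mem_singleton, Prod.neg_mk, Prod.mk.injEq]
    omega
  rw [this]
  simp only [stepLaw, PMF.toMeasure_apply_singleton _ _ (measurableSet_singleton _),
    PMF.uniformOfFinset_apply, hmem]
  split_ifs <;> rfl

/-- The steps and, separately, the holding times of a pair of noises. The entries of the first noise
have the indices `Sum.inl k`, those of the second the indices `Sum.inr k`. Steps and holding times
are kept apart because time reversal permutes them differently. -/
abbrev FlatNoise : Type := (ℕ ⊕ ℕ → Site) × (ℕ ⊕ ℕ → ℝ)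

/-- All steps uniform, all holding times exponential, everything independent. -/
def flatNoiseLaw : Measure FlatNoise :=
  (Measure.infinitePi fun _ => stepLaw).prod (Measure.infinitePi fun _ => expMeasure 1)

/-- The pair of noises with the given steps and holding times. -/
def noisePair (u : FlatNoise) : Noise × Noise :=
  (fun k => (u.1 (Sum.inl k), u.2 (Sum.inl k)), fun k => (u.1 (Sum.inr k), u.2 (Sum.inr k)))

lemma measurePreserving_noisePair :
    MeasurePreserving noisePair flatNoiseLaw (noiseLaw.prod noiseLaw) :=
  (measurePreserving_sumElim_infinitePi (stepLaw.prod (expMeasure 1))).comp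
    (measurePreserving_zip_infinitePi stepLaw (expMeasure 1))

/-- Where the rerooted pair of walks takes its steps from when the root moves from time `0` to the
`m`-th jump of the forward walk: the new backward walk first retraces the `m` forward steps and then
follows the old backward walk, and the new forward walk follows the old one from step `m` on. -/
def stepIndex (m : ℕ) : ℕ ⊕ ℕ → ℕ ⊕ ℕ
  | Sum.inl k => if k < m then Sum.inr (m - 1 - k) else Sum.inl (k - m)
  | Sum.inr k => Sum.inr (m + k)

/-- The retraced steps are reversed. -/
def stepSign (m : ℕ) : ℕ ⊕ ℕ → Site → Site
  | Sum.inl k => if k < m then fun e => -e else id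
  | Sum.inr _ => id

/-- Where the rerooted pair of walks takes its holding times from. Before step `k` with `1 ≤ k ≤ m`
the new backward walk rests where the forward walk rested before step `m - k`. The entry `Sum.inl 0`
does not show in the two-sided path and stays in place, so that the map is injective. -/
def timeIndex (m : ℕ) : ℕ ⊕ ℕ → ℕ ⊕ ℕ
  | Sum.inl k => if k = 0 then Sum.inl 0 else if k ≤ m then Sum.inr (m - k) else Sum.inl (k - m)
  | Sum.inr k => Sum.inr (m + k)

lemma injective_stepIndex (m : ℕ) : Function.Injective (stepIndex m) := by
  rintro (i | i) (j | j) <;> simp only [stepIndex] <;> (try split_ifs) <;> simp <;> omega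

lemma injective_timeIndex (m : ℕ) : Function.Injective (timeIndex m) := by
  rintro (i | i) (j | j) <;> simp only [timeIndex] <;> (try split_ifs) <;> simp <;> omega

/-- The noise of the same two-sided path with its root moved to the `m`-th jump of the forward
walk. -/
def reroot (m : ℕ) (u : FlatNoise) : FlatNoise :=
  (fun j => stepSign m j (u.1 (stepIndex m j)), fun j => u.2 (timeIndex m j))

lemma measurePreserving_reroot (m : ℕ) :
    MeasurePreserving (reroot m) flatNoiseLaw flatNoiseLaw := by
  refine (measurePreserving_reindex_infinitePi stepLaw (injective_stepIndex m)
    (g := stepSign m) ?_).prod (measurePreserving_reindex_infinitePi (expMeasure 1)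
    (injective_timeIndex m) (g := fun _ => id) fun _ => MeasurePreserving.id _)
  rintro (k | k)
  · simp only [stepSign]
    split_ifs
    · exact measurePreserving_neg_stepLaw
    · exact MeasurePreserving.id _
  · exact MeasurePreserving.id _

/-! ### Rerooting a trajectory at a later jump -/

lemma skeleton_reroot_snd {m : ℕ} {u : FlatNoise} {x a : Site}
    (ha : skeleton x m (noisePair u).2 = a) (n : ℕ) :
    skeleton a n (noisePair (reroot m u)).2 = skeleton x (m + n) (noisePair u).2 := by
  induction n with
  | zero => rw [skeleton_zero, add_zero, ha]
  | succ n ih => rw [skeleton_succ, ih, ← add_assoc, skeleton_succ]; rfl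

lemma jumpTime_reroot_snd (m : ℕ) (u : FlatNoise) (n : ℕ) :
    jumpTime n (noisePair (reroot m u)).2 =
      jumpTime (m + n) (noisePair u).2 - jumpTime m (noisePair u).2 := by
  induction n with
  | zero => simp [jumpTime_zero]
  | succ n ih =>
    rw [jumpTime_succ, ih, ← add_assoc, jumpTime_succ]
    change _ + ((noisePair u).2 (m + n)).2 = _
    ring

/-- The first `m` backward steps from the new root retrace the forward walk. -/
lemma skeleton_reroot_fst_of_le {m : ℕ} (u : FlatNoise) (x a : Site) {k : ℕ} (hk : k ≤ m) :
    skeleton a k (noisePair (reroot m u)).1 =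
      a + (skeleton x (m - k) (noisePair u).2 - skeleton x m (noisePair u).2) := by
  induction k with
  | zero => simp [skeleton_zero]
  | succ k ih =>
    have hstep : ((noisePair (reroot m u)).1 k).1 = -((noisePair u).2 (m - 1 - k)).1 := by
      simp only [noisePair, reroot, stepIndex, stepSign, if_pos (show k < m by omega)]
    have h₁ : m - k = m - (k + 1) + 1 := by omega
    have h₂ : m - 1 - k = m - (k + 1) := by omega
    rw [skeleton_succ, ih (by omega), hstep, h₂, h₁, skeleton_succ]
    abel

/-- After `m` steps the rerooted backward walk continues as the old backward walk. -/
lemma skeleton_reroot_fst_add {m : ℕ} {u : FlatNoise} {x a : Site}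
    (ha : skeleton x m (noisePair u).2 = a) (k : ℕ) :
    skeleton a (m + k) (noisePair (reroot m u)).1 = skeleton x k (noisePair u).1 := by
  induction k with
  | zero =>
    rw [add_zero, skeleton_reroot_fst_of_le u x a le_rfl, Nat.sub_self, skeleton_zero,
      skeleton_zero, ha]
    abel
  | succ k ih =>
    have hstep : ((noisePair (reroot m u)).1 (m + k)).1 = ((noisePair u).1 k).1 := by
      simp [noisePair, reroot, stepIndex, stepSign]
    rw [← add_assoc, skeleton_succ, ih, hstep, skeleton_succ]

/-- The rerooted backward walk spends the holding times of the forward walk in reversed order. The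
first holding time is left aside, as the backward walk is seen from its first jump on. -/
lemma jumpTime_reroot_fst {m : ℕ} (u : FlatNoise) {k : ℕ} (hk : k ≤ m) :
    jumpTime (k + 1) (noisePair (reroot m u)).1 = jumpTime 1 (noisePair (reroot m u)).1 +
      (jumpTime m (noisePair u).2 - jumpTime (m - k) (noisePair u).2) := by
  induction k with
  | zero => simp
  | succ k ih =>
    have htime : ((noisePair (reroot m u)).1 (k + 1)).2 = ((noisePair u).2 (m - (k + 1))).2 := by
      simp only [noisePair, reroot, timeIndex, if_pos hk, if_neg (Nat.succ_ne_zero k)]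
    have h₁ : m - k = m - (k + 1) + 1 := by omega
    rw [jumpTime_succ (k + 1), ih (by omega), htime, h₁, jumpTime_succ (m - (k + 1))]
    ring

section Shift

variable {F : Finset Site} {x a : Site} {m : ℕ} {u : FlatNoise}

/-- Rerooting at the `m`-th jump of the forward walk shifts the time by that jump's time, provided
the backward walk leaves `F` at its first jump and the forward walk is still alive. -/
lemma gluePath_reroot (h₂ : Regular (noisePair u).2) (h₁ : Regular (noisePair u).1)
    (h₁' : Regular (noisePair (reroot m u)).1) (h₂' : Regular (noisePair (reroot m u)).2)
    (hexit : skeleton x 1 (noisePair u).1 ∉ F)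
    (hF : ∀ i ≤ m, skeleton x i (noisePair u).2 ∈ F) (ha : skeleton x m (noisePair u).2 = a)
    (t : ℝ) : gluePath F a (noisePair (reroot m u)) t =
      gluePath F x (noisePair u) (t + jumpTime m (noisePair u).2) := by
  classical
  set ω := noisePair u
  set ω' := noisePair (reroot m u)
  by_cases ht : 0 ≤ t
  · obtain ⟨n, hn, hn'⟩ := h₂'.exists_mem_Ico ht
    rw [gluePath_of_nonneg h₂' hn hn']
    rw [jumpTime_reroot_snd] at hn hn'
    rw [gluePath_of_nonneg (n := m + n) h₂ (by linarith) (by rw [add_assoc]; linarith),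
      skeleton_reroot_snd ha]
    refine if_congr ⟨fun h i hi => ?_, fun h i hi => ?_⟩ rfl rfl
    · rcases le_total i m with him | him
      · exact hF i him
      · have := h (i - m) (by omega)
        rwa [skeleton_reroot_snd ha, Nat.add_sub_cancel' him] at this
    · rw [skeleton_reroot_snd ha]
      exact h (m + i) (by omega)
  · obtain ⟨n, h1n, hn, hn'⟩ := h₁'.exists_mem_Ioc (m := 1) (t := jumpTime 1 ω'.1 - t)
      (by linarith)
    rw [gluePath_of_neg h₁' h1n hn hn']
    rcases le_or_gt n m with hnm | hmn
    · -- the path passes the site number `m - n` of the forward walk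
      obtain ⟨k, rfl⟩ : ∃ k, n = k + 1 := ⟨n - 1, by omega⟩
      have hsk : ∀ i ≤ m, skeleton a i ω'.1 = skeleton x (m - i) ω.2 := fun i hi => by
        rw [skeleton_reroot_fst_of_le u x a hi, ha]; abel
      rw [jumpTime_reroot_fst u (by omega)] at hn
      rw [jumpTime_reroot_fst u hnm] at hn'
      have h₃ : m - k = m - (k + 1) + 1 := by omega
      rw [h₃] at hn
      rw [gluePath_of_nonneg (n := m - (k + 1)) h₂ (by linarith) (by linarith),
        if_pos fun i hi => ?_, if_pos fun i hi => hF i (by omega), hsk _ hnm]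
      rw [hsk i (by omega)]; exact hF _ (by omega)
    · -- both paths have been killed
      have hlow : jumpTime m ω.2 + t < 0 := by
        have h₃ := jumpTime_reroot_fst u (le_refl m)
        rw [Nat.sub_self, jumpTime_zero] at h₃
        have h₄ := h₁'.jumpTime_le_iff.2 hmn
        change jumpTime (m + 1) ω'.1 ≤ _ at h₄
        linarith
      rw [gluePath_eq_cemetery_of_lt h₁ le_rfl hexit (by linarith),
        if_neg fun h => hexit ?_]
      rw [← skeleton_reroot_fst_add ha]
      exact h _ hmn

lemma piStar_glue_reroot (h₂ : Regular (noisePair u).2) (h₁ : Regular (noisePair u).1)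
    (h₁' : Regular (noisePair (reroot m u)).1) (h₂' : Regular (noisePair (reroot m u)).2)
    (hexit : skeleton x 1 (noisePair u).1 ∉ F)
    (hF : ∀ i ≤ m, skeleton x i (noisePair u).2 ∈ F) (ha : skeleton x m (noisePair u).2 = a) :
    piStar (glue F a (noisePair (reroot m u))) = piStar (glue F x (noisePair u)) := by
  refine (piStar_eq_iff.2 ⟨jumpTime m (noisePair u).2, fun t => ?_⟩).symm
  have hx : x ∈ F := by simpa [skeleton_zero] using hF 0 m.zero_le
  rw [glue_val h₁ h₂ hx, glue_val h₁' h₂' (ha ▸ hF m le_rfl),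
    gluePath_reroot h₂ h₁ h₁' h₂' hexit hF ha]

end Shift

/-! ### The sweeping identity -/

section Sweeping

variable {K F A : Finset Site}

/-- The event, for the trajectory rooted at its start `x`, that its skeleton enters `A` at its
`m`-th jump and at the site `a`, that the conditions under which it is counted by `Q K F F` hold,
and that the trajectory modulo time shift lies in `B`. The condition `skeleton x 1 ω.1 ∉ F` says
that the trajectory is not alive at negative times. -/
def firstVisit (K F A : Finset Site) (B : Set TrajectoryStar) (x a : Site) (m : ℕ) :
    Set (Noise × Noise) :=
  {ω | (a ∈ A ∧ skeleton x 1 ω.1 ∉ F ∧ (∀ i < m, skeleton x i ω.2 ∈ F ∧ skeleton x i ω.2 ∉ A) ∧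
    skeleton x m ω.2 = a ∧ ∃ n, skeleton x n ω.2 ∉ F ∧ ∀ i ≤ n, skeleton x i ω.2 ∉ K) ∧
    piStar (glue F x ω) ∈ B}

/-- The event, for the trajectory rooted at its first visit `a` to `A`, that it started `m` jumps
earlier at `x`, that the conditions under which it is counted by `Q K F A` hold, and that the
trajectory modulo time shift lies in `B`. Read backwards in time, the path from `a` leaves `A` for
good at once. -/
def lastExit (K F A : Finset Site) (B : Set TrajectoryStar) (x a : Site) (m : ℕ) :
    Set (Noise × Noise) :=
  {ω | (a ∈ A ∧ skeleton a (m + 1) ω.1 ∉ F ∧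
    (∀ i, 1 ≤ i → i ≤ m → skeleton a i ω.1 ∈ F ∧ skeleton a i ω.1 ∉ A) ∧
    skeleton a m ω.1 = x ∧ ∃ n, skeleton a n ω.2 ∉ F ∧ ∀ i ≤ n, skeleton a i ω.2 ∉ K) ∧
    piStar (glue F a ω) ∈ B}

/-- Rerooting turns the trajectories counted at their start into those counted at their first visit
to `A`. The part of the path before that visit avoids `A`, hence `K`, so that the condition of
avoiding `K` concerns the later part only. -/
lemma mem_firstVisit_iff_mem_lastExit (hKA : K ⊆ A) (hAF : A ⊆ F) {B : Set TrajectoryStar}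
    {x a : Site} {m : ℕ} {u : FlatNoise} (h₁ : Regular (noisePair u).1)
    (h₂ : Regular (noisePair u).2)
    (h₁' : Regular (noisePair (reroot m u)).1) (h₂' : Regular (noisePair (reroot m u)).2) :
    noisePair u ∈ firstVisit K F A B x a m ↔
      noisePair (reroot m u) ∈ lastExit K F A B x a m := by
  have hends : skeleton x m (noisePair u).2 = a ↔
      skeleton a m (noisePair (reroot m u)).1 = x := by
    rw [skeleton_reroot_fst_of_le u x a le_rfl, Nat.sub_self, skeleton_zero]
    constructor
    · rintro rfl; abel
    · intro h
      rw [← sub_eq_zero] at h ⊢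
      rw [← neg_eq_zero, ← h]; abel
  by_cases ha : skeleton x m (noisePair u).2 = a
  swap
  · simp [firstVisit, lastExit, ha, hends.not.1 ha]
  have ha' := hends.1 ha
  by_cases haA : a ∈ A
  swap
  · simp [firstVisit, lastExit, haA]
  have hexit : skeleton a (m + 1) (noisePair (reroot m u)).1 = skeleton x 1 (noisePair u).1 :=
    skeleton_reroot_fst_add ha 1
  have hpast : ∀ i ≤ m, skeleton a i (noisePair (reroot m u)).1 =
      skeleton x (m - i) (noisePair u).2 := fun i hi => by
    rw [skeleton_reroot_fst_of_le u x a hi, ha]; abel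
  have hpast_iff : (∀ i < m, skeleton x i (noisePair u).2 ∈ F ∧ skeleton x i (noisePair u).2 ∉ A) ↔
      ∀ i, 1 ≤ i → i ≤ m → skeleton a i (noisePair (reroot m u)).1 ∈ F ∧
        skeleton a i (noisePair (reroot m u)).1 ∉ A := by
    constructor
    · intro h i hi him
      rw [hpast i him]; exact h _ (by omega)
    · intro h i him
      have := h (m - i) (by omega) (by omega)
      rwa [hpast _ (by omega), Nat.sub_sub_self him.le] at this
  have hA : (∀ i < m, skeleton x i (noisePair u).2 ∈ F ∧ skeleton x i (noisePair u).2 ∉ A) →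
      ((∃ n, skeleton x n (noisePair u).2 ∉ F ∧ ∀ i ≤ n, skeleton x i (noisePair u).2 ∉ K) ↔
      ∃ n, skeleton a n (noisePair (reroot m u)).2 ∉ F ∧
        ∀ i ≤ n, skeleton a i (noisePair (reroot m u)).2 ∉ K) := by
    intro h
    simp only [skeleton_reroot_snd ha]
    constructor
    · rintro ⟨n, hn, hnK⟩
      have hmn : m ≤ n := not_lt.1 fun hnm => hn (h n hnm).1
      refine ⟨n - m, by rwa [Nat.add_sub_cancel' hmn], fun i hi => hnK _ (by omega)⟩
    · rintro ⟨n, hn, hnK⟩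
      refine ⟨m + n, hn, fun i hi => ?_⟩
      rcases lt_or_ge i m with him | him
      · exact fun hiK => (h i him).2 (hKA hiK)
      · have := hnK (i - m) (by omega)
        rwa [Nat.add_sub_cancel' him] at this
  simp only [firstVisit, lastExit, Set.mem_ofPred_eq, hexit, ← hpast_iff, ha, ha', haA, true_and]
  constructor
  · rintro ⟨⟨he, hp, hK⟩, hB⟩
    refine ⟨⟨he, hp, (hA hp).1 hK⟩, ?_⟩
    rwa [piStar_glue_reroot h₂ h₁ h₁' h₂' he (fun i hi => ?_) ha]
    rcases hi.lt_or_eq with hi | rfl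
    · exact (hp i hi).1
    · exact ha ▸ hAF haA
  · rintro ⟨⟨he, hp, hK⟩, hB⟩
    refine ⟨⟨he, hp, (hA hp).2 hK⟩, ?_⟩
    rwa [piStar_glue_reroot h₂ h₁ h₁' h₂' he (fun i hi => ?_) ha] at hB
    rcases hi.lt_or_eq with hi | rfl
    · exact (hp i hi).1
    · exact ha ▸ hAF haA

lemma nullMeasurableSet_preimage_glue {x : Site} (hx : x ∈ F) {B : Set TrajectoryStar}
    (hB : MeasurableSet B) :
    NullMeasurableSet {ω | piStar (glue F x ω) ∈ B} (noiseLaw.prod noiseLaw) :=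
  (measurable_piStar.comp_aemeasurable (aemeasurable_glue hx)).nullMeasurable hB

lemma measurable_skeleton_mem_fst (x : Site) (n : ℕ) (S : Set Site) :
    Measurable fun ω : Noise × Noise => skeleton x n ω.1 ∈ S :=
  measurableSet_setOfPred.1
    (((measurable_skeleton x n).comp measurable_fst) (Set.to_countable S).measurableSet)

lemma measurable_skeleton_mem_snd (x : Site) (n : ℕ) (S : Set Site) :
    Measurable fun ω : Noise × Noise => skeleton x n ω.2 ∈ S :=
  measurableSet_setOfPred.1
    (((measurable_skeleton x n).comp measurable_snd) (Set.to_countable S).measurableSet)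

lemma firstVisit_eq_empty (hAF : A ⊆ F) {B : Set TrajectoryStar} {x a : Site} {m : ℕ}
    (hx : x ∉ F) : firstVisit K F A B x a m = ∅ := by
  refine Set.eq_empty_of_forall_notMem fun ω hω => hx ?_
  obtain ⟨⟨ha, -, hlt, hm, -⟩, -⟩ := hω
  rcases Nat.eq_zero_or_pos m with rfl | hpos
  · rw [skeleton_zero] at hm
    exact hm ▸ hAF ha
  · simpa [skeleton_zero] using (hlt 0 hpos).1

lemma nullMeasurableSet_firstVisit (hAF : A ⊆ F) {B : Set TrajectoryStar} (hB : MeasurableSet B)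
    (x a : Site) (m : ℕ) :
    NullMeasurableSet (firstVisit K F A B x a m) (noiseLaw.prod noiseLaw) := by
  by_cases hx : x ∈ F
  · refine NullMeasurableSet.inter (MeasurableSet.nullMeasurableSet ?_)
      (nullMeasurableSet_preimage_glue hx hB)
    have h₁ := fun n (S : Set Site) => measurable_skeleton_mem_fst x n S
    have h₂ := fun n (S : Set Site) => measurable_skeleton_mem_snd x n S
    refine measurableSet_setOfPred.2 (measurable_const.and ((h₁ 1 F).not.and (Measurable.and
      (Measurable.forall fun i => Measurable.forall fun _ => (h₂ i F).and (h₂ i A).not)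
      ((h₂ m {a}).and (Measurable.exists fun n => (h₂ n F).not.and
        (Measurable.forall fun i => Measurable.forall fun _ => (h₂ i K).not))))))
  · rw [firstVisit_eq_empty hAF hx]; exact MeasurableSet.empty.nullMeasurableSet

lemma nullMeasurableSet_lastExit (hAF : A ⊆ F) {B : Set TrajectoryStar} (hB : MeasurableSet B)
    (x a : Site) (m : ℕ) :
    NullMeasurableSet (lastExit K F A B x a m) (noiseLaw.prod noiseLaw) := by
  by_cases ha : a ∈ F
  · refine NullMeasurableSet.inter (MeasurableSet.nullMeasurableSet ?_)
      (nullMeasurableSet_preimage_glue ha hB)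
    have h₁ := fun n (S : Set Site) => measurable_skeleton_mem_fst a n S
    have h₂ := fun n (S : Set Site) => measurable_skeleton_mem_snd a n S
    refine measurableSet_setOfPred.2 (measurable_const.and ((h₁ (m + 1) F).not.and (Measurable.and
      (Measurable.forall fun i => Measurable.forall fun _ => Measurable.forall fun _ =>
        (h₁ i F).and (h₁ i A).not)
      ((h₁ m {x}).and (Measurable.exists fun n => (h₂ n F).not.and
        (Measurable.forall fun i => Measurable.forall fun _ => (h₂ i K).not))))))
  · have : lastExit K F A B x a m = ∅ :=
      Set.eq_empty_of_forall_notMem fun ω hω => ha (hAF hω.1.1)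
    rw [this]; exact MeasurableSet.empty.nullMeasurableSet

lemma measure_firstVisit_eq_measure_lastExit (hKA : K ⊆ A) (hAF : A ⊆ F)
    {B : Set TrajectoryStar} (hB : MeasurableSet B) (x a : Site) (m : ℕ) :
    noiseLaw.prod noiseLaw (firstVisit K F A B x a m) =
      noiseLaw.prod noiseLaw (lastExit K F A B x a m) := by
  have hreg : ∀ᵐ u ∂flatNoiseLaw, Regular (noisePair u).1 ∧ Regular (noisePair u).2 :=
    measurePreserving_noisePair.quasiMeasurePreserving.ae ae_regular_pair
  rw [← measurePreserving_noisePair.measure_preimage (nullMeasurableSet_firstVisit hAF hB x a m),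
    ← (measurePreserving_noisePair.comp (measurePreserving_reroot m)).measure_preimage
      (nullMeasurableSet_lastExit hAF hB x a m)]
  refine measure_congr (Filter.eventuallyEq_set.2 ?_)
  filter_upwards [hreg, (measurePreserving_reroot m).quasiMeasurePreserving.ae hreg] with u h h'
  exact mem_firstVisit_iff_mem_lastExit hKA hAF h.1 h.2 h'.1 h'.2

/-- Up to regularity, the trajectories counted by `Q K F F` at `x` that visit `A` are classified by
the index and the site of their first visit to `A`. -/
lemma mem_iUnion_firstVisit_iff (hAF : A ⊆ F) {B : Set TrajectoryStar} {x : Site} (hx : x ∈ F)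
    {ω : Noise × Noise} (h₁ : Regular ω.1) (h₂ : Regular ω.2) :
    ω ∈ ⋃ p : Site × ℕ, firstVisit K F A B x p.1 p.2 ↔
      piStar (glue F x ω) ∈ B ∩ enteringStar A ∧ ω ∈ noReturn x F F ×ˢ avoids x K F := by
  classical
  have hret : ω.1 ∈ noReturn x F F ↔ skeleton x 1 ω.1 ∉ F := by
    rw [h₁.mem_noReturn_iff]
    constructor
    · rintro ⟨n, hn, hall⟩
      refine hall 1 le_rfl (Nat.one_le_iff_ne_zero.2 ?_)
      rintro rfl
      exact hn (by rwa [skeleton_zero])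
    · exact fun h => ⟨1, h, fun i hi hi' => by rwa [le_antisymm hi' hi]⟩
  have hent : skeleton x 1 ω.1 ∉ F → (piStar (glue F x ω) ∈ enteringStar A ↔
      ∃ n, (∀ i ≤ n, skeleton x i ω.2 ∈ F) ∧ skeleton x n ω.2 ∈ A) := by
    intro hexit
    rw [← Set.mem_preimage, preimage_enteringStar]
    change (∃ t, ∃ y ∈ (A : Set Site), (glue F x ω).1 t = alive y) ↔ _
    rw [glue_val h₁ h₂ hx]
    constructor
    · rintro ⟨t, y, hy, hty⟩
      rcases lt_or_ge t 0 with ht | ht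
      · rw [gluePath_eq_cemetery_of_lt h₁ le_rfl hexit (by linarith)] at hty
        exact absurd hty.symm (alive_ne_cemetery y)
      · obtain ⟨n, hall, -, -, rfl⟩ := (gluePath_eq_alive_iff_of_nonneg h₂ ht y).1 hty
        exact ⟨n, hall, hy⟩
    · rintro ⟨n, hall, hn⟩
      exact ⟨jumpTime n ω.2, _, hn, (gluePath_eq_alive_iff_of_nonneg h₂ (h₂.jumpTime_nonneg n)
        _).2 ⟨n, hall, le_rfl, h₂.jumpTime_lt_iff.2 n.lt_succ_self, rfl⟩⟩
  rw [Set.mem_prod, hret, h₂.mem_avoids_iff, Set.mem_iUnion, Prod.exists]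
  constructor
  · rintro ⟨a, m, ⟨ha, hexit, hlt, hm, hK⟩, hB⟩
    refine ⟨⟨hB, (hent hexit).2 ⟨m, fun i hi => ?_, hm ▸ ha⟩⟩, hexit, hK⟩
    rcases hi.lt_or_eq with hi | rfl
    · exact (hlt i hi).1
    · exact hm ▸ hAF ha
  · rintro ⟨⟨hB, hE⟩, hexit, hK⟩
    have hex := (hent hexit).1 hE
    have hs := Nat.find_spec hex
    refine ⟨_, Nat.find hex, ⟨hs.2, hexit, fun i hi => ⟨hs.1 i hi.le, fun hiA => ?_⟩, rfl, hK⟩, hB⟩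
    exact Nat.find_min hex hi ⟨fun k hk => hs.1 k (hk.trans hi.le), hiA⟩

/-- Up to regularity, the trajectories counted by `Q K F A` at `a` are classified by the number of
their backward jumps inside `F` and the site where they start. -/
lemma mem_iUnion_lastExit_iff (hAF : A ⊆ F) {B : Set TrajectoryStar} {a : Site} (ha : a ∈ A)
    {ω : Noise × Noise} (h₁ : Regular ω.1) (h₂ : Regular ω.2) :
    ω ∈ ⋃ p : Site × ℕ, lastExit K F A B p.1 a p.2 ↔
      piStar (glue F a ω) ∈ B ∧ ω ∈ noReturn a A F ×ˢ avoids a K F := by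
  rw [Set.mem_prod, h₁.mem_noReturn_iff, h₂.mem_avoids_iff, Set.mem_iUnion, Prod.exists]
  constructor
  · rintro ⟨x, m, ⟨-, hexit, hlt, -, hK⟩, hB⟩
    refine ⟨hB, ⟨m + 1, hexit, fun i hi hi' => ?_⟩, hK⟩
    rcases hi'.lt_or_eq with hi' | rfl
    · exact (hlt i hi (by omega)).2
    · exact fun h => hexit (hAF h)
  · rintro ⟨hB, ⟨n, hn, hnA⟩, hK⟩
    obtain ⟨N, hN, hlt⟩ := h₁.exists_exitIndex F a
    have hNn : N ≤ n := not_lt.1 fun h => hn (hlt n h)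
    obtain ⟨m, rfl⟩ : ∃ m, N = m + 1 := Nat.exists_eq_succ_of_ne_zero fun h0 =>
      hN (by rw [h0, skeleton_zero]; exact hAF ha)
    exact ⟨skeleton a m ω.1, m,
      ⟨ha, hN, fun i hi hi' => ⟨hlt i (by omega), hnA i hi (by omega)⟩, rfl, hK⟩, hB⟩

lemma pairwise_disjoint_firstVisit (B : Set TrajectoryStar) (x : Site) :
    Pairwise (Function.onFun Disjoint fun p : Site × ℕ => firstVisit K F A B x p.1 p.2) := by
  rintro ⟨a, m⟩ ⟨b, n⟩ hne
  refine Set.disjoint_left.2 ?_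
  rintro ω ⟨⟨ha, -, hlt, hm, -⟩, -⟩ ⟨⟨hb, -, hlt', hn, -⟩, -⟩
  rcases lt_trichotomy m n with h | rfl | h
  · exact (hlt' m h).2 (hm ▸ ha)
  · exact hne (Prod.ext (hm.symm.trans hn) rfl)
  · exact (hlt n h).2 (hn ▸ hb)

lemma pairwise_disjoint_lastExit (B : Set TrajectoryStar) (a : Site) :
    Pairwise (Function.onFun Disjoint fun p : Site × ℕ => lastExit K F A B p.1 a p.2) := by
  rintro ⟨x, m⟩ ⟨y, n⟩ hne
  refine Set.disjoint_left.2 ?_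
  rintro ω ⟨⟨-, hm, hlt, hx, -⟩, -⟩ ⟨⟨-, hn, hlt', hy, -⟩, -⟩
  rcases lt_trichotomy m n with h | rfl | h
  · exact hm (hlt' (m + 1) (by omega) h).1
  · exact hne (Prod.ext (hx.symm.trans hy) rfl)
  · exact hn (hlt (n + 1) (by omega) h).1

/-- This includes the case `μ s = 0`, in which `cond μ s` is the zero measure. -/
lemma measure_smul_cond {Ω : Type*} [MeasurableSpace Ω] (μ : Measure Ω) [IsFiniteMeasure μ]
    (s : Set Ω) : μ s • ProbabilityTheory.cond μ s = μ.restrict s := by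
  by_cases h : μ s = 0
  · rw [h, zero_smul, Measure.restrict_eq_zero.2 h]
  · rw [ProbabilityTheory.cond, smul_smul, ENNReal.mul_inv_cancel h (measure_ne_top μ s), one_smul]

/-- The weights `rho` cancel the normalizations of the conditional laws. -/
lemma Q_eq (K F A : Finset Site) : Q K F A = ∑ x ∈ A, ((noiseLaw.prod noiseLaw).restrict
    (noReturn x A F ×ˢ avoids x K F)).map (glue F x) := by
  refine Finset.sum_congr rfl fun x hx => ?_
  rw [rho, if_pos hx, eqMeasure, if_pos hx, ← Measure.map_smul, ← Measure.prod_restrict,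
    ← measure_smul_cond, ← measure_smul_cond, Measure.prod_smul_left, Measure.prod_smul_right,
    smul_smul]

instance isFiniteMeasure_Q (K F A : Finset Site) : IsFiniteMeasure (Q K F A) := by
  rw [Q_eq]; infer_instance

lemma map_piStar_Q_apply (hAF : A ⊆ F) {B : Set TrajectoryStar} (hB : MeasurableSet B) :
    (Q K F A).map piStar B = ∑ x ∈ A, noiseLaw.prod noiseLaw
      {ω | piStar (glue F x ω) ∈ B ∧ ω ∈ noReturn x A F ×ˢ avoids x K F} := by
  rw [Measure.map_apply measurable_piStar hB, Q_eq, Measure.finsetSum_apply]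
  refine Finset.sum_congr rfl fun x hx => ?_
  have hglue := aemeasurable_glue (hAF hx)
  rw [Measure.map_apply_of_aemeasurable hglue.restrict (measurable_piStar hB)]
  exact Measure.restrict_apply₀ ((nullMeasurableSet_preimage_glue (hAF hx) hB).mono_ac
      Measure.restrict_le_self.absolutelyContinuous)

/-- The sweeping identity: the image of `Q K F F` in `W*`, restricted to the trajectories that visit
`A`, is the image of `Q K F A`. -/
lemma restrict_map_piStar_Q (hKA : K ⊆ A) (hAF : A ⊆ F) :
    ((Q K F F).map piStar).restrict (enteringStar A) = (Q K F A).map piStar := by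
  ext B hB
  have hfirst : ∀ x ∈ F, noiseLaw.prod noiseLaw {ω | piStar (glue F x ω) ∈ B ∩ enteringStar A ∧
      ω ∈ noReturn x F F ×ˢ avoids x K F} =
      ∑' p : Site × ℕ, noiseLaw.prod noiseLaw (firstVisit K F A B x p.1 p.2) := fun x hx => by
    rw [← measure_iUnion₀ (fun p q hpq => (pairwise_disjoint_firstVisit B x hpq).aedisjoint)
      fun p => nullMeasurableSet_firstVisit hAF hB x p.1 p.2]
    refine measure_congr (Filter.eventuallyEq_set.2 ?_)
    filter_upwards [ae_regular_pair] with ω hω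
    exact (mem_iUnion_firstVisit_iff hAF hx hω.1 hω.2).symm
  have hlast : ∀ a ∈ A, noiseLaw.prod noiseLaw {ω | piStar (glue F a ω) ∈ B ∧
      ω ∈ noReturn a A F ×ˢ avoids a K F} =
      ∑' p : Site × ℕ, noiseLaw.prod noiseLaw (lastExit K F A B p.1 a p.2) := fun a ha => by
    rw [← measure_iUnion₀ (fun p q hpq => (pairwise_disjoint_lastExit B a hpq).aedisjoint)
      fun p => nullMeasurableSet_lastExit hAF hB p.1 a p.2]
    refine measure_congr (Filter.eventuallyEq_set.2 ?_)
    filter_upwards [ae_regular_pair] with ω hω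
    exact (mem_iUnion_lastExit_iff hAF ha hω.1 hω.2).symm
  -- `firstVisit` is empty for starting points outside `F`, `lastExit` for sites outside `A`
  have hsumF : ∀ x ∉ F, ∑' p : Site × ℕ,
      noiseLaw.prod noiseLaw (firstVisit K F A B x p.1 p.2) = 0 := fun x hx => by
    refine ENNReal.tsum_eq_zero.2 fun p => ?_
    rw [firstVisit_eq_empty hAF hx, measure_empty]
  have hsumA : ∀ a ∉ A, ∑' p : Site × ℕ,
      noiseLaw.prod noiseLaw (lastExit K F A B p.1 a p.2) = 0 := fun a ha => by
    refine ENNReal.tsum_eq_zero.2 fun p => ?_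
    rw [Set.eq_empty_of_forall_notMem fun ω (hω : ω ∈ lastExit K F A B p.1 a p.2) => ha hω.1.1,
      measure_empty]
  rw [Measure.restrict_apply hB,
    map_piStar_Q_apply subset_rfl (hB.inter (measurableSet_enteringStar A)),
    map_piStar_Q_apply hAF hB, Finset.sum_congr rfl hfirst, Finset.sum_congr rfl hlast,
    ← tsum_eq_sum (L := .unconditional Site) hsumF,
    ← tsum_eq_sum (L := .unconditional Site) hsumA]
  simp only [ENNReal.tsum_prod' (α := Site) (β := ℕ),
    measure_firstVisit_eq_measure_lastExit hKA hAF hB]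
  exact ENNReal.tsum_comm

lemma map_piStar_Q_compl_enteringStar (K F : Finset Site) :
    (Q K F F).map piStar (enteringStar F)ᶜ = 0 := by
  rw [map_piStar_Q_apply subset_rfl (measurableSet_enteringStar _).compl]
  refine Finset.sum_eq_zero fun x hx => ?_
  refine measure_mono_null ?_ (ae_iff.1 ae_regular_pair)
  rintro ω ⟨hω, -⟩ ⟨h₁, h₂⟩
  refine hω ⟨_, ⟨0, x, hx, ?_⟩, rfl⟩
  rw [glue_val h₁ h₂ hx, gluePath_eq_alive_iff_of_nonneg h₂ le_rfl]
  refine ⟨0, fun i hi => ?_, (jumpTime_zero _).le, ?_, skeleton_zero _ _⟩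
  · rwa [Nat.le_zero.1 hi, skeleton_zero]
  · rw [← jumpTime_zero ω.2]; exact h₂.jumpTime_lt_iff.2 one_pos

end Sweeping

end

theorem theoremT (K K' : Finset Site) (hKK' : K ⊆ K') :
    ∃! ν : Measure TrajectoryStar,
      IsFiniteMeasure ν ∧
      ν (enteringStar (K' : Set Site))ᶜ = 0 ∧
      ∀ A : Finset Site, K ⊆ A → A ⊆ K' →
        ν.restrict (enteringStar (A : Set Site)) = (Q K K' A).map piStar := by
  refine ⟨(Q K K' K').map piStar, ⟨inferInstance, map_piStar_Q_compl_enteringStar K K',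
    fun A hKA hAK' => restrict_map_piStar_Q hKA hAK'⟩, ?_⟩
  rintro ν ⟨-, hν, hall⟩
  rw [← hall K' hKK' subset_rfl]
  exact (Measure.restrict_eq_self_of_ae_mem hν).symm
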